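/- Let $\mathcal A$ be a (strict) 2-category, let $F\colon\mathcal A\to\mathbf{Cat}$ be a (strict) 2-functor and let $\Delta 1$ denote a 2-functor constant at the terminal category. All lax natural transformations $\varphi\colon L\Rightarrow U$ have structure 2-cells $\varphi_f\colon U(f)\circ\varphi_A\Rightarrow\varphi_B\circ L(f)$ for $f\colon A\to B$. The 2-category of elements $\int F$ has as objects the pairs $(A,X)$ with $A\in\mathcal A$ and $X\in F(A)$; as morphisms $(A,X)\to(B,Y)$ the pairs $(f,\alpha)$ with $f\colon A\to B$ in $\mathcal A$ and $\alpha\colon F(f)(X)\to Y$ in $F(B)$; and as 2-cells $(f,\alpha)\Rightarrow(g,\beta)$ the 2-cells $\delta\colon f\Rightarrow g$ of $\mathcal A$ with $\alpha=\beta\circ F(\delta)_X$. Let $\pi\colon\int F\to\mathcal A$ be the projection, and let $\lambda\colon\Delta 1\Rightarrow F\circ\pi$ be the lax natural transformation whose component at $(A,X)$ is the functor $1\to F(A)$ picking $X$ and whose structure 2-cell on $(f,\alpha)$ is $\alpha$. For 2-categories $\mathcal B,\mathcal C$, write $[\mathcal B,\mathcal C]_{\mathrm{lax}}$ for the 2-category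 of 2-functors $\mathcal B\to\mathcal C$, lax natural transformations and modifications. Then $\lambda$ exhibits $F$ as the weak left Kan extension of $\Delta 1$ along $\pi$ in the lax 3-category of 2-categories, 2-functors, lax natural transformations and modifications; that is, for every 2-functor $U\colon\mathcal A\to\mathbf{Cat}$ the functor given by pasting with $\lambda$, $\varphi\mapsto(\varphi\ast\pi)\circ\lambda$, is an isomorphism of categories $$[\mathcal A,\mathbf{Cat}]_{\mathrm{lax}}(F,U)\;\cong\;[\textstyle\int F,\mathbf{Cat}]_{\mathrm{lax}}(\Delta 1,U\circ\pi).$$ These isomorphisms are 2-natural in $U\in[\mathcal A,\mathbf{Cat}]_{\mathrm{lax}}$. Moreover, for every $U$, the isomorphism restricts to isomorphisms between the following full subcategories: (i) the pseudonatural transformations $F\Rightarrow U$ (all structure 2-cells invertible) and the sigma natural transformations $\Delta 1\Rightarrow U\circ\pi$ (the structure 2-cells on all morphisms $(f,\mathrm{id})\colon(A,X)\to(B,F(f)(X))$ of $\int F$ are invertible); (ii) the 2-natural transformations $F\Rightarrow U$ (all structure 2-cells are identities) and the cartesian-marked lax natural transformations $\Delta 1\Rightarrow U\circ\pi$ (the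 structure 2-cells on all morphisms $(f,\mathrm{id})$ of $\int F$ are identities). -/

import Mathlib

/-!
Strict 2-categories are Mathlib's strict bicategories, 2-functors are Mathlib's strict
pseudofunctors, and lax natural transformations and modifications are Mathlib's
`Lax.LaxTrans` and `Lax.LaxTrans.Modification`; the hom-category of two objects of
`A ⥤ᴸ C` therefore consists of lax natural transformations and modifications.
-/

open CategoryTheory Bicategory
open scoped CategoryTheory.Lax.LaxTrans CategoryTheory.Lax.LaxTrans.LaxFunctor

universe w w₁ w₂ v v₁ v₂ v' u u₁ u₂ u'

/-- A 2-functor, viewed as an object of the 2-category of lax functors, lax natural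
transformations and modifications. For 2-functors `L` and `U`, the category
`laxOf L ⟶ laxOf U` is the hom-category of `L` and `U` in the 2-category of 2-functors,
lax natural transformations and modifications. -/
abbrev laxOf {A : Type u} [Bicategory.{w, v} A] {C : Type u₁} [Bicategory.{w₁, v₁} C]
    (F : StrictPseudofunctor A C) : LaxFunctor A C :=
  F.toPseudofunctor.toLax

section WeakKanExtension

variable {A : Type u} [Bicategory.{w, v} A] {B : Type u₁} [Bicategory.{w₁, v₁} B]
  {C : Type u₂} [Bicategory.{w₂, v₂} C]

/-- The whiskering `φ * K` of a lax natural transformation `φ : L ⟶ U` with a 2-functor `K`. -/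
def restrictTrans (K : StrictPseudofunctor B A) {L U : StrictPseudofunctor A C}
    (φ : laxOf L ⟶ laxOf U) : laxOf (K.comp L) ⟶ laxOf (K.comp U) where
  app b := φ.app (K.obj b)
  naturality f := φ.naturality (K.map f)
  naturality_naturality η := φ.naturality_naturality (K.map₂ η)
  naturality_id b := by
    have h : φ.app (K.obj b) ◁ ((laxOf U).mapId (K.obj b) ≫ (laxOf U).map₂ (K.mapId b).inv) ≫
        φ.naturality (K.map (𝟙 b)) =
        (ρ_ (φ.app (K.obj b))).hom ≫ (λ_ (φ.app (K.obj b))).inv ≫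
          ((laxOf L).mapId (K.obj b) ≫ (laxOf L).map₂ (K.mapId b).inv) ▷ φ.app (K.obj b) := by
      rw [whiskerLeft_comp, Category.assoc, ← φ.naturality_naturality, ← Category.assoc,
        comp_whiskerRight, φ.naturality_id]
      simp only [Category.assoc]
    exact h
  naturality_comp {a b c} f g := by
    have h : φ.app (K.obj a) ◁ ((laxOf U).mapComp (K.map f) (K.map g) ≫
          (laxOf U).map₂ (K.mapComp f g).inv) ≫ φ.naturality (K.map (f ≫ g)) =
        (α_ _ _ _).inv ≫ φ.naturality (K.map f) ▷ (laxOf U).map (K.map g) ≫ (α_ _ _ _).hom ≫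
          (laxOf L).map (K.map f) ◁ φ.naturality (K.map g) ≫ (α_ _ _ _).inv ≫
          ((laxOf L).mapComp (K.map f) (K.map g) ≫
            (laxOf L).map₂ (K.mapComp f g).inv) ▷ φ.app (K.obj c) := by
      rw [whiskerLeft_comp, Category.assoc, ← φ.naturality_naturality, ← Category.assoc,
        comp_whiskerRight, φ.naturality_comp]
      simp only [Category.assoc]
    exact h

/-- Whiskering with a 2-functor `K`, as a functor from the lax natural transformations `L ⟶ U`
to the lax natural transformations `L ∘ K ⟶ U ∘ K`. -/
def restrictFunctor (K : StrictPseudofunctor B A) (L U : StrictPseudofunctor A C) :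
    (laxOf L ⟶ laxOf U) ⥤ (laxOf (K.comp L) ⟶ laxOf (K.comp U)) where
  obj φ := restrictTrans K φ
  map Γ := ⟨{ app := fun b => Γ.as.app (K.obj b)
              naturality := fun f => Γ.as.naturality (K.map f) }⟩

/-- Pasting with a lax natural transformation `lam : G ⟶ L ∘ K`: the functor
`φ ↦ (φ * K) ∘ lam`. -/
def pasting {K : StrictPseudofunctor B A} {G : StrictPseudofunctor B C}
    {L : StrictPseudofunctor A C}
    (lam : laxOf G ⟶ laxOf (K.comp L)) (U : StrictPseudofunctor A C) :
    (laxOf L ⟶ laxOf U) ⥤ (laxOf G ⟶ laxOf (K.comp U)) :=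
  restrictFunctor K L U ⋙ precomp (B := LaxFunctor B C) (laxOf (K.comp U)) lam

/-- The lax natural transformation `lam : G ⟶ L ∘ K` exhibits `L` as the weak left Kan extension
of `G` along `K` in the lax 3-category of 2-categories, 2-functors, lax natural transformations
and modifications: for every 2-functor `U`, pasting with `lam` is an isomorphism between the
category of lax natural transformations `L ⟶ U` and that of lax natural transformations
`G ⟶ U ∘ K`. -/
def IsWeakLeftKanExtension [Bicategory.Strict A] [Bicategory.Strict B] [Bicategory.Strict C]
    {K : StrictPseudofunctor B A} {G : StrictPseudofunctor B C}
    {L : StrictPseudofunctor A C} (lam : laxOf G ⟶ laxOf (K.comp L)) : Prop :=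
  ∀ U : StrictPseudofunctor A C, (pasting lam U).IsIso

/-- The functors `pasting lam U` are 2-natural in `U`, where `U` runs over the 2-category of
2-functors, lax natural transformations and modifications: they commute with postcomposition
with lax natural transformations `θ : U ⟶ U'`, and with modifications between those. -/
structure PastingIsTwoNatural {K : StrictPseudofunctor B A} {G : StrictPseudofunctor B C}
    {L : StrictPseudofunctor A C} (lam : laxOf G ⟶ laxOf (K.comp L)) : Prop where
  natural {U U' : StrictPseudofunctor A C} (θ : laxOf U ⟶ laxOf U') :
    pasting lam U ⋙ (postcomposing (B := LaxFunctor B C) (laxOf G) _ _).obj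
        ((restrictFunctor K U U').obj θ) =
      (postcomposing (B := LaxFunctor A C) (laxOf L) _ _).obj θ ⋙ pasting lam U'
  natural_two {U U' : StrictPseudofunctor A C} {θ θ' : laxOf U ⟶ laxOf U'} (Γ : θ ⟶ θ') :
    Functor.whiskerLeft (pasting lam U)
        ((postcomposing (B := LaxFunctor B C) (laxOf G) _ _).map
          ((restrictFunctor K U U').map Γ)) =
      eqToHom (natural θ) ≫
        Functor.whiskerRight ((postcomposing (B := LaxFunctor A C) (laxOf L) _ _).map Γ)
          (pasting lam U') ≫
        eqToHom (natural θ').symm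

/-- A 2-cell is an identity. -/
def IsIdentityTwoCell {a b : C} {f g : a ⟶ b} (η : f ⟶ g) : Prop :=
  ∃ h : f = g, η = eqToHom h

/-- Pseudonatural transformations: all the structure 2-cells are invertible. -/
def isPseudonatural (L U : StrictPseudofunctor A C) : ObjectProperty (laxOf L ⟶ laxOf U) :=
  fun φ => ∀ ⦃a b : A⦄ (f : a ⟶ b), IsIso (φ.naturality f)

/-- (Strict) 2-natural transformations: all the structure 2-cells are identities. -/
def isTwoNatural (L U : StrictPseudofunctor A C) : ObjectProperty (laxOf L ⟶ laxOf U) :=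
  fun φ => ∀ ⦃a b : A⦄ (f : a ⟶ b), IsIdentityTwoCell (φ.naturality f)

end WeakKanExtension

/-- The functor `P` restricts to an isomorphism between the full subcategories on the objects
satisfying `p` and on the objects satisfying `q`. -/
def RestrictsToIso {C : Type u} [Category.{v} C] {D : Type u₁} [Category.{v₁} D] (P : C ⥤ D)
    (p : ObjectProperty C) (q : ObjectProperty D) : Prop :=
  ∃ h : ∀ X, p X → q (P.obj X), (q.lift (p.ι ⋙ P) (fun X => h X.obj X.property)).IsIso

section Elements

variable {A : Type u} [Bicategory.{w, v} A]

/-- The objects of the 2-category of elements of `F`: pairs `(a, x)` with `x` in `F a`. -/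
structure Elements (F : StrictPseudofunctor A Cat.{v', u'}) where
  base : A
  fiber : F.obj base

namespace Elements

variable {F : StrictPseudofunctor A Cat.{v', u'}}

/-- A morphism `(a, x) ⟶ (b, y)`: a pair `(f, α)` with `f : a ⟶ b` and `α : F f x ⟶ y`. -/
structure Hom (x y : Elements F) where
  base : x.base ⟶ y.base
  fiber : (F.map base).toFunctor.obj x.fiber ⟶ y.fiber

/-- A 2-cell `(f, α) ⟶ (g, β)`: a 2-cell `δ : f ⟶ g` with `α = β ∘ F δ x`. -/
structure Hom₂ {x y : Elements F} (f g : Hom x y) where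
  base : f.base ⟶ g.base
  w : f.fiber = (F.map₂ base).toNatTrans.app x.fiber ≫ g.fiber

instance : CategoryStruct (Elements F) where
  Hom x y := Hom x y
  id x := ⟨𝟙 x.base, (F.mapId x.base).hom.toNatTrans.app x.fiber⟩
  comp {x _ _} f g := ⟨f.base ≫ g.base, (F.mapComp f.base g.base).hom.toNatTrans.app x.fiber ≫
    (F.map g.base).toFunctor.map f.fiber ≫ g.fiber⟩

@[ext]
lemma Hom₂.ext_base {x y : Elements F} {f g : Hom x y} {a b : Hom₂ f g} (h : a.base = b.base) : a = b := by
  cases a; cases b; cases h; rfl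

instance (x y : Elements F) : Category (x ⟶ y) where
  Hom f g := Hom₂ f g
  id f := ⟨𝟙 f.base, by simp⟩
  comp a b := ⟨a.base ≫ b.base, by rw [a.w, b.w]; simp⟩
  id_comp a := Hom₂.ext_base (Category.id_comp a.base)
  comp_id a := Hom₂.ext_base (Category.comp_id a.base)
  assoc a b c := Hom₂.ext_base (Category.assoc a.base b.base c.base)

/-- Constructor for invertible 2-cells. -/
def isoMk {x y : Elements F} {f g : x ⟶ y} (e : f.base ≅ g.base)
    (w : f.fiber = (F.map₂ e.hom).toNatTrans.app x.fiber ≫ g.fiber) : f ≅ g where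
  hom := ⟨e.hom, w⟩
  inv := ⟨e.inv, by
    rw [w, ← Category.assoc, ← Cat.Hom₂.comp_app, ← F.map₂_comp]; simp⟩
  hom_inv_id := Hom₂.ext_base e.hom_inv_id
  inv_hom_id := Hom₂.ext_base e.inv_hom_id


/-- Constructor for 2-cells. -/
def mk₂ {x y : Elements F} {f g : x ⟶ y} (δ : f.base ⟶ g.base)
    (w : f.fiber = (F.map₂ δ).toNatTrans.app x.fiber ≫ g.fiber) : f ⟶ g :=
  Hom₂.mk δ w

/-- The 2-cell of the base underlying a 2-cell. -/
abbrev base₂ {x y : Elements F} {f g : x ⟶ y} (η : f ⟶ g) : f.base ⟶ g.base :=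
  Hom₂.base η

lemma base₂_w {x y : Elements F} {f g : x ⟶ y} (η : f ⟶ g) :
    f.fiber = (F.map₂ (base₂ η)).toNatTrans.app x.fiber ≫ g.fiber :=
  Hom₂.w η

lemma ext₂ {x y : Elements F} {f g : x ⟶ y} {η θ : f ⟶ g} (h : base₂ η = base₂ θ) : η = θ :=
  Hom₂.ext_base h

lemma comp_fiber {x y z : Elements F} (f : x ⟶ y) (g : y ⟶ z) :
    (f ≫ g).fiber = (F.mapComp f.base g.base).hom.toNatTrans.app x.fiber ≫
      (F.map g.base).toFunctor.map f.fiber ≫ g.fiber := rfl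

lemma id_fiber (x : Elements F) :
    Hom.fiber (𝟙 x) = (F.mapId x.base).hom.toNatTrans.app x.fiber := rfl

/-- Left whiskering. -/
def whiskerLeft₂ {x y z : Elements F} (f : x ⟶ y) {g h : y ⟶ z} (η : g ⟶ h) : f ≫ g ⟶ f ≫ h :=
  mk₂ (f.base ◁ base₂ η) (by
    have := (F.map₂ (base₂ η)).toNatTrans.naturality f.fiber
    rw [comp_fiber, comp_fiber, base₂_w η, F.map₂_whisker_left]
    simp only [Cat.Hom₂.comp_app, Cat.whiskerLeft_app, Category.assoc,
      Cat.Hom.inv_hom_id_toNatTrans_app_assoc]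
    rw [reassoc_of% this])

/-- Right whiskering. -/
def whiskerRight₂ {x y z : Elements F} {f g : x ⟶ y} (η : f ⟶ g) (h : y ⟶ z) : f ≫ h ⟶ g ≫ h :=
  mk₂ (base₂ η ▷ h.base) (by
    rw [comp_fiber, comp_fiber, base₂_w η, F.map₂_whisker_right]
    simp only [Cat.Hom₂.comp_app, Cat.whiskerRight_app, Category.assoc, Functor.map_comp,
      Cat.Hom.inv_hom_id_toNatTrans_app_assoc])

/-- The associator, inherited from the base. -/
def associator₂ {x y z t : Elements F} (f : x ⟶ y) (g : y ⟶ z) (h : z ⟶ t) :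
    (f ≫ g) ≫ h ≅ f ≫ g ≫ h :=
  isoMk (α_ f.base g.base h.base) (by
    rw [comp_fiber, comp_fiber, comp_fiber, comp_fiber, F.map₂_associator]
    have hn := (F.mapComp g.base h.base).hom.toNatTrans.naturality f.fiber
    simp only [Cat.Hom₂.comp_app, Cat.whiskerRight_app, Cat.whiskerLeft_app,
      Cat.associator_hom_app, eqToHom_refl, Category.id_comp, Functor.map_comp, Category.assoc]
    erw [reassoc_of% hn, Cat.Hom.inv_hom_id_toNatTrans_app_assoc,
      Cat.Hom.inv_hom_id_toNatTrans_app_assoc]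
    rfl)

/-- The left unitor, inherited from the base. -/
def leftUnitor₂ {x y : Elements F} (f : x ⟶ y) : 𝟙 x ≫ f ≅ f :=
  isoMk (λ_ f.base) (by
    rw [comp_fiber, id_fiber, F.map₂_left_unitor]
    simp
    rfl)

/-- The right unitor, inherited from the base. -/
def rightUnitor₂ {x y : Elements F} (f : x ⟶ y) : f ≫ 𝟙 y ≅ f :=
  isoMk (ρ_ f.base) (by
    rw [comp_fiber, id_fiber, F.map₂_right_unitor]
    simp
    rfl)

/-- The 2-category of elements of `F`, with compositions inherited from the base. -/
instance : Bicategory (Elements F) where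
  whiskerLeft f _ _ η := whiskerLeft₂ f η
  whiskerRight η h := whiskerRight₂ η h
  associator f g h := associator₂ f g h
  leftUnitor f := leftUnitor₂ f
  rightUnitor f := rightUnitor₂ f
  whiskerLeft_id f g := ext₂ (whiskerLeft_id f.base g.base)
  whiskerLeft_comp f _ _ _ η θ := ext₂ (whiskerLeft_comp f.base (base₂ η) (base₂ θ))
  id_whiskerLeft η := ext₂ (id_whiskerLeft (base₂ η))
  comp_whiskerLeft f g _ _ η := ext₂ (comp_whiskerLeft f.base g.base (base₂ η))
  id_whiskerRight f g := ext₂ (id_whiskerRight f.base g.base)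
  comp_whiskerRight η θ i := ext₂ (comp_whiskerRight (base₂ η) (base₂ θ) i.base)
  whiskerRight_id η := ext₂ (whiskerRight_id (base₂ η))
  whiskerRight_comp η g h := ext₂ (whiskerRight_comp (base₂ η) g.base h.base)
  whisker_assoc f _ _ η h := ext₂ (whisker_assoc f.base (base₂ η) h.base)
  whisker_exchange η θ := ext₂ (whisker_exchange (base₂ η) (base₂ θ))
  pentagon f g h i := ext₂ (pentagon f.base g.base h.base i.base)
  triangle f g := ext₂ (triangle f.base g.base)

lemma hom_ext {x y : Elements F} {f g : x ⟶ y} (h : f.base = g.base)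
    (h' : f.fiber = eqToHom (by rw [h]) ≫ g.fiber) : f = g := by
  obtain ⟨f, a⟩ := f
  obtain ⟨g, b⟩ := g
  dsimp at h
  subst h
  have : a = b := by simpa using h'
  rw [this]

lemma base₂_eqToHom {x y : Elements F} {f g : x ⟶ y} (h : f = g) :
    base₂ (eqToHom h) = eqToHom (by rw [h]) := by
  subst h; rfl

lemma fiber_eq_of_base₂ {x y : Elements F} {f g : x ⟶ y} (η : f ⟶ g) (h : f.base = g.base)
    (h' : base₂ η = eqToHom h) : f = g := by
  refine hom_ext h ?_
  rw [base₂_w η, h', PrelaxFunctor.map₂_eqToHom, Cat.eqToHom_app]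

instance [Bicategory.Strict A] : Bicategory.Strict (Elements F) where
  id_comp f := fiber_eq_of_base₂ (λ_ f).hom (Bicategory.Strict.id_comp f.base)
    (congrArg Iso.hom (Bicategory.Strict.leftUnitor_eqToIso f.base))
  comp_id f := fiber_eq_of_base₂ (ρ_ f).hom (Bicategory.Strict.comp_id f.base)
    (congrArg Iso.hom (Bicategory.Strict.rightUnitor_eqToIso f.base))
  assoc f g h := fiber_eq_of_base₂ (α_ f g h).hom (Bicategory.Strict.assoc f.base g.base h.base)
    (congrArg Iso.hom (Bicategory.Strict.associator_eqToIso f.base g.base h.base))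
  leftUnitor_eqToIso f := Iso.ext (ext₂ (by
    rw [eqToIso.hom, base₂_eqToHom]
    exact congrArg Iso.hom (Bicategory.Strict.leftUnitor_eqToIso f.base)))
  rightUnitor_eqToIso f := Iso.ext (ext₂ (by
    rw [eqToIso.hom, base₂_eqToHom]
    exact congrArg Iso.hom (Bicategory.Strict.rightUnitor_eqToIso f.base)))
  associator_eqToIso f g h := Iso.ext (ext₂ (by
    rw [eqToIso.hom, base₂_eqToHom]
    exact congrArg Iso.hom (Bicategory.Strict.associator_eqToIso f.base g.base h.base)))

variable (F) in
/-- The projection 2-functor, from the 2-category of elements to the base. -/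
def proj [Bicategory.Strict A] : StrictPseudofunctor (Elements F) A :=
  StrictPseudofunctor.mk''
    { obj := fun x => x.base
      map := fun f => f.base
      map₂ := fun η => base₂ η
      map₂_id := fun _ => rfl
      map₂_comp := fun _ _ => rfl
      map_id := fun _ => rfl
      map_comp := fun _ _ => rfl
      map₂_whisker_left := fun f _ _ η => by
        simp only [eqToHom_refl, Category.id_comp, Category.comp_id]; rfl
      map₂_whisker_right := fun η f => by
        simp only [eqToHom_refl, Category.id_comp, Category.comp_id]; rfl }

end Elements

/-- The 2-functor `Δ1`, constant at the terminal category. -/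
def constOne (B : Type u₁) [Bicategory.{w₁, v₁} B] [Bicategory.Strict B] :
    StrictPseudofunctor B Cat.{v', u'} :=
  StrictPseudofunctor.mk''
    { obj := fun _ => Cat.chosenTerminal
      map := fun _ => 𝟙 _
      map₂ := fun _ => 𝟙 _
      map₂_id := fun _ => rfl
      map₂_comp := fun _ _ => rfl
      map_id := fun _ => rfl
      map_comp := fun _ _ => rfl
      map₂_whisker_left := fun f _ _ η => by
        rw [whiskerLeft_id]; rfl
      map₂_whisker_right := fun η f => by
        rw [id_whiskerRight]; rfl }

/-- The lax natural transformation from `Δ1` to `F ∘ proj F` whose component at `(a, x)` is the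
functor picking `x` and whose structure 2-cell on `(f, α)` is `α`. -/
def Elements.cone [Bicategory.Strict A] (F : StrictPseudofunctor A Cat.{v', u'}) :
    laxOf (constOne (Elements F)) ⟶ laxOf ((Elements.proj F).comp F) where
  app x := ((Functor.const Cat.chosenTerminal).obj x.fiber).toCatHom
  naturality {x y} f := ⟨{
    app := fun _ => f.fiber
    naturality := fun _ _ _ => by
      change (F.map f.base).toFunctor.map (𝟙 _) ≫ f.fiber = f.fiber ≫ 𝟙 _
      rw [CategoryTheory.Functor.map_id, Category.id_comp, Category.comp_id] }⟩
  naturality_naturality {x y f g} η := by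
    apply Cat.Hom₂.ext
    ext
    change f.fiber ≫ 𝟙 _ = (F.map₂ (base₂ η)).toNatTrans.app x.fiber ≫ g.fiber
    rw [Category.comp_id, base₂_w η]
  naturality_id x := by
    apply Cat.Hom₂.ext
    ext
    change ((F.mapId x.base).inv.toNatTrans.app x.fiber ≫
      (F.map₂ (𝟙 (𝟙 x.base))).toNatTrans.app x.fiber) ≫
      (F.mapId x.base).hom.toNatTrans.app x.fiber = 𝟙 _ ≫ 𝟙 _ ≫ 𝟙 _
    rw [F.map₂_id]
    simp
  naturality_comp {x y z} f g := by
    apply Cat.Hom₂.ext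
    ext
    change ((F.mapComp f.base g.base).inv.toNatTrans.app x.fiber ≫
      (F.map₂ (𝟙 (f.base ≫ g.base))).toNatTrans.app x.fiber) ≫
      (F.mapComp f.base g.base).hom.toNatTrans.app x.fiber ≫
      (F.map g.base).toFunctor.map f.fiber ≫ g.fiber =
      𝟙 _ ≫ (F.map g.base).toFunctor.map f.fiber ≫ 𝟙 _ ≫ g.fiber ≫ 𝟙 _ ≫ 𝟙 _
    rw [F.map₂_id]
    simp

namespace Elements

variable {F : StrictPseudofunctor A Cat.{v', u'}}

/-- The chosen cartesian lifting `(f, id) : (a, x) ⟶ (b, F f x)` of `f` at `x`. -/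
def lift {a b : A} (f : a ⟶ b) (x : F.obj a) :
    (⟨a, x⟩ : Elements F) ⟶ ⟨b, (F.map f).toFunctor.obj x⟩ :=
  Hom.mk f (𝟙 _)

variable {D : Type u₂} [Bicategory.{w₂, v₂} D]

/-- Sigma natural transformations: lax natural transformations whose structure 2-cells on all
the morphisms of the form `(f, id)` are invertible. -/
def isSigma (M N : StrictPseudofunctor (Elements F) D) : ObjectProperty (laxOf M ⟶ laxOf N) :=
  fun φ => ∀ ⦃a b : A⦄ (f : a ⟶ b) (x : F.obj a), IsIso (φ.naturality (lift f x))

/-- Cartesian-marked lax natural transformations: lax natural transformations whose structure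
2-cells on all the morphisms of the form `(f, id)` are identities. -/
def isCartesianMarked (M N : StrictPseudofunctor (Elements F) D) :
    ObjectProperty (laxOf M ⟶ laxOf N) :=
  fun φ => ∀ ⦃a b : A⦄ (f : a ⟶ b) (x : F.obj a), IsIdentityTwoCell (φ.naturality (lift f x))

end Elements

end Elements

namespace CategoryTheory.Lax.LaxTrans

variable {B : Type u₁} [Bicategory.{w₁, v₁} B] {M N : B ⥤ᴸ Cat.{v', u'}}

/-- The value at an object of the structure 2-cell of a lax transformation between `Cat`-valued
functors. -/
abbrev cell (φ : M ⟶ N) {a b : B} (f : a ⟶ b) (x : M.obj a) :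
    (N.map f).toFunctor.obj ((φ.app a).toFunctor.obj x) ⟶
      (φ.app b).toFunctor.obj ((M.map f).toFunctor.obj x) :=
  (φ.naturality f).toNatTrans.app x

lemma cell_map₂ (φ : M ⟶ N) {a b : B} {f g : a ⟶ b} (η : f ⟶ g) (x : M.obj a) :
    cell φ f x ≫ (φ.app b).toFunctor.map ((M.map₂ η).toNatTrans.app x) =
      (N.map₂ η).toNatTrans.app ((φ.app a).toFunctor.obj x) ≫ cell φ g x :=
  congrArg (fun t => t.toNatTrans.app x) (φ.naturality_naturality η)

lemma cell_id (φ : M ⟶ N) (a : B) (x : M.obj a) :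
    (N.mapId a).toNatTrans.app ((φ.app a).toFunctor.obj x) ≫ cell φ (𝟙 a) x =
      (φ.app a).toFunctor.map ((M.mapId a).toNatTrans.app x) := by
  have h := congrArg (fun t => t.toNatTrans.app x) (φ.naturality_id a)
  change _ = 𝟙 _ ≫ 𝟙 _ ≫ (φ.app a).toFunctor.map ((M.mapId a).toNatTrans.app x) at h
  rw [Category.id_comp, Category.id_comp] at h
  exact h

lemma cell_comp (φ : M ⟶ N) {a b c : B} (f : a ⟶ b) (g : b ⟶ c) (x : M.obj a) :
    (N.mapComp f g).toNatTrans.app ((φ.app a).toFunctor.obj x) ≫ cell φ (f ≫ g) x =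
      (N.map g).toFunctor.map (cell φ f x) ≫ cell φ g ((M.map f).toFunctor.obj x) ≫
        (φ.app c).toFunctor.map ((M.mapComp f g).toNatTrans.app x) := by
  have h := congrArg (fun t => t.toNatTrans.app x) (φ.naturality_comp f g)
  change _ = 𝟙 _ ≫ (N.map g).toFunctor.map (cell φ f x) ≫ 𝟙 _ ≫
    cell φ g ((M.map f).toFunctor.obj x) ≫ 𝟙 _ ≫
      (φ.app c).toFunctor.map ((M.mapComp f g).toNatTrans.app x) at h
  simp only [Category.id_comp] at h
  exact h

/-- A lax transformation between `Cat`-valued functors, from its values on objects. -/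
def ofCells (P : ∀ a, M.obj a ⥤ N.obj a)
    (n : ∀ {a b : B} (f : a ⟶ b) (x : M.obj a),
      (N.map f).toFunctor.obj ((P a).obj x) ⟶ (P b).obj ((M.map f).toFunctor.obj x))
    (naturality : ∀ {a b : B} (f : a ⟶ b) {x y : M.obj a} (k : x ⟶ y),
      (N.map f).toFunctor.map ((P a).map k) ≫ n f y =
        n f x ≫ (P b).map ((M.map f).toFunctor.map k))
    (map₂ : ∀ {a b : B} {f g : a ⟶ b} (η : f ⟶ g) (x : M.obj a),
      n f x ≫ (P b).map ((M.map₂ η).toNatTrans.app x) =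
        (N.map₂ η).toNatTrans.app ((P a).obj x) ≫ n g x)
    (id : ∀ (a : B) (x : M.obj a),
      (N.mapId a).toNatTrans.app ((P a).obj x) ≫ n (𝟙 a) x =
        (P a).map ((M.mapId a).toNatTrans.app x))
    (comp : ∀ {a b c : B} (f : a ⟶ b) (g : b ⟶ c) (x : M.obj a),
      (N.mapComp f g).toNatTrans.app ((P a).obj x) ≫ n (f ≫ g) x =
        (N.map g).toFunctor.map (n f x) ≫ n g ((M.map f).toFunctor.obj x) ≫
          (P c).map ((M.mapComp f g).toNatTrans.app x)) : M ⟶ N where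
  app a := (P a).toCatHom
  naturality f := ⟨{ app := n f, naturality := fun _ _ k => naturality f k }⟩
  naturality_naturality η := Cat.Hom₂.ext (by ext x; exact map₂ η x)
  naturality_id a := Cat.Hom₂.ext (by
    ext x
    change _ = 𝟙 _ ≫ 𝟙 _ ≫ (P a).map ((M.mapId a).toNatTrans.app x)
    rw [Category.id_comp, Category.id_comp]
    exact id a x)
  naturality_comp {a b c} f g := Cat.Hom₂.ext (by
    ext x
    change _ = 𝟙 _ ≫ (N.map g).toFunctor.map (n f x) ≫ 𝟙 _ ≫
      n g ((M.map f).toFunctor.obj x) ≫ 𝟙 _ ≫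
        (P c).map ((M.mapComp f g).toNatTrans.app x)
    simp only [Category.id_comp]
    exact comp f g x)

lemma ext_cells {φ ψ : M ⟶ N}
    (obj : ∀ a x, (φ.app a).toFunctor.obj x = (ψ.app a).toFunctor.obj x)
    (map : ∀ a {x y : M.obj a} (k : x ⟶ y),
      (φ.app a).toFunctor.map k ≍ (ψ.app a).toFunctor.map k)
    (cells : ∀ {a b : B} (f : a ⟶ b) (x : M.obj a), cell φ f x ≍ cell ψ f x) : φ = ψ := by
  obtain ⟨p, n, _, _, _⟩ := φ
  obtain ⟨q, m, _, _, _⟩ := ψ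
  obtain rfl : p = q := by
    funext a
    exact Cat.ext (CategoryTheory.Functor.hext (obj a) fun _ _ k => map a k)
  obtain rfl : @n = @m := by
    funext a b f
    refine Cat.Hom₂.ext ?_
    ext x
    exact eq_of_heq (cells f x)
  rfl

lemma hom_ext_app {φ ψ : M ⟶ N} {Γ Γ' : φ ⟶ ψ}
    (h : ∀ a x, (Γ.as.app a).toNatTrans.app x = (Γ'.as.app a).toNatTrans.app x) : Γ = Γ' := by
  ext a x
  exact h a x

lemma modification_naturality_app {φ ψ : M ⟶ N} (Γ : φ ⟶ ψ) {a b : B} (f : a ⟶ b)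
    (x : M.obj a) :
    (N.map f).toFunctor.map ((Γ.as.app a).toNatTrans.app x) ≫ cell ψ f x =
      cell φ f x ≫ (Γ.as.app b).toNatTrans.app ((M.map f).toFunctor.obj x) :=
  congrArg (fun t => t.toNatTrans.app x) (Γ.as.naturality f)

/-- A morphism of lax transformations between `Cat`-valued functors, from its values on objects. -/
def homOfApp {φ ψ : M ⟶ N}
    (t : ∀ a (x : M.obj a), (φ.app a).toFunctor.obj x ⟶ (ψ.app a).toFunctor.obj x)
    (naturality : ∀ a {x y : M.obj a} (k : x ⟶ y),
      (φ.app a).toFunctor.map k ≫ t a y = t a x ≫ (ψ.app a).toFunctor.map k)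
    (cells : ∀ {a b : B} (f : a ⟶ b) (x : M.obj a),
      (N.map f).toFunctor.map (t a x) ≫ cell ψ f x =
        cell φ f x ≫ t b ((M.map f).toFunctor.obj x)) : φ ⟶ ψ :=
  ⟨{ app := fun a => ⟨{ app := t a, naturality := fun _ _ k => naturality a k }⟩
     naturality := fun f => Cat.Hom₂.ext (by ext x; exact cells f x) }⟩

end CategoryTheory.Lax.LaxTrans

lemma Cat.isIso_iff_app {C D : Cat.{v', u'}} {P Q : C ⟶ D} (η : P ⟶ Q) :
    IsIso η ↔ ∀ x, IsIso (η.toNatTrans.app x) := by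
  constructor
  · intro h x
    exact ((Cat.Hom.toNatIso (asIso η)).app x).isIso_hom
  · intro h
    have := NatIso.isIso_of_isIso_app η.toNatTrans
    exact (Cat.Hom.isoMk (asIso η.toNatTrans)).isIso_hom

lemma Cat.isIdentityTwoCell_iff_app {C D : Cat.{v', u'}} {P Q : C ⟶ D} (η : P ⟶ Q) :
    IsIdentityTwoCell η ↔
      ∀ x, ∃ h : P.toFunctor.obj x = Q.toFunctor.obj x, η.toNatTrans.app x = eqToHom h := by
  constructor
  · rintro ⟨rfl, rfl⟩ x
    exact ⟨rfl, rfl⟩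
  · intro h
    have e : P = Q := Cat.ext (CategoryTheory.Functor.ext (fun x => (h x).1) fun x y k => by
      have n := η.toNatTrans.naturality k
      rw [(h x).2, (h y).2] at n
      rw [← reassoc_of% n, eqToHom_trans, eqToHom_refl, Category.comp_id])
    subst e
    refine ⟨rfl, Cat.Hom₂.ext ?_⟩
    ext x
    exact (h x).2

lemma RestrictsToIso.of_iff {C : Type u} [Category.{v} C] {D : Type u₁} [Category.{v₁} D]
    {P : C ⥤ D} (hP : P.IsIso) {p : ObjectProperty C} {q : ObjectProperty D}
    (h : ∀ X, p X ↔ q (P.obj X)) : RestrictsToIso P p q := by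
  refine ⟨fun X => (h X).1, ?_⟩
  refine { faithful := inferInstance, full := inferInstance, bijective_obj := ⟨?_, ?_⟩ }
  · rintro ⟨X, hX⟩ ⟨Y, hY⟩ e
    obtain rfl : X = Y := hP.bijective_obj.1 (congrArg ObjectProperty.FullSubcategory.obj e)
    rfl
  · rintro ⟨Y, hY⟩
    obtain ⟨X, rfl⟩ := hP.bijective_obj.2 Y
    exact ⟨⟨X, (h X).2 hY⟩, rfl⟩

namespace CategoryTheory.StrictPseudofunctor

variable {A : Type u} [Bicategory.{w, v} A] (U : StrictPseudofunctor A Cat.{v', u'})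

/-- The value at an object of the unit comparison. -/
def idHom (a : A) (x : U.obj a) : (U.map (𝟙 a)).toFunctor.obj x ⟶ x :=
  (U.mapId a).hom.toNatTrans.app x

/-- The value at an object of the inverse of the unit comparison. -/
def idInv (a : A) (x : U.obj a) : x ⟶ (U.map (𝟙 a)).toFunctor.obj x :=
  (U.mapId a).inv.toNatTrans.app x

/-- The value at an object of the composition comparison. -/
def compHom {a b c : A} (f : a ⟶ b) (g : b ⟶ c) (x : U.obj a) :
    (U.map (f ≫ g)).toFunctor.obj x ⟶ (U.map g).toFunctor.obj ((U.map f).toFunctor.obj x) :=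
  (U.mapComp f g).hom.toNatTrans.app x

/-- The value at an object of the inverse of the composition comparison. -/
def compInv {a b c : A} (f : a ⟶ b) (g : b ⟶ c) (x : U.obj a) :
    (U.map g).toFunctor.obj ((U.map f).toFunctor.obj x) ⟶ (U.map (f ≫ g)).toFunctor.obj x :=
  (U.mapComp f g).inv.toNatTrans.app x

lemma idHom_idInv (a : A) (x : U.obj a) : U.idHom a x ≫ U.idInv a x = 𝟙 _ :=
  Cat.Hom.hom_inv_id_toNatTrans_app (U.mapId a) x

lemma idInv_idHom (a : A) (x : U.obj a) : U.idInv a x ≫ U.idHom a x = 𝟙 _ :=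
  Cat.Hom.inv_hom_id_toNatTrans_app (U.mapId a) x

lemma compHom_compInv {a b c : A} (f : a ⟶ b) (g : b ⟶ c) (x : U.obj a) :
    U.compHom f g x ≫ U.compInv f g x = 𝟙 _ :=
  Cat.Hom.hom_inv_id_toNatTrans_app (U.mapComp f g) x

lemma compInv_compHom {a b c : A} (f : a ⟶ b) (g : b ⟶ c) (x : U.obj a) :
    U.compInv f g x ≫ U.compHom f g x = 𝟙 _ :=
  Cat.Hom.inv_hom_id_toNatTrans_app (U.mapComp f g) x

lemma idHom_naturality (a : A) {x y : U.obj a} (k : x ⟶ y) :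
    (U.map (𝟙 a)).toFunctor.map k ≫ U.idHom a y = U.idHom a x ≫ k :=
  (U.mapId a).hom.toNatTrans.naturality k

lemma idInv_naturality (a : A) {x y : U.obj a} (k : x ⟶ y) :
    k ≫ U.idInv a y = U.idInv a x ≫ (U.map (𝟙 a)).toFunctor.map k :=
  (U.mapId a).inv.toNatTrans.naturality k

lemma idInv_map₂_id (a : A) (x : U.obj a) :
    U.idInv a x ≫ (U.map₂ (𝟙 (𝟙 a))).toNatTrans.app x = U.idInv a x := by
  rw [U.map₂_id, Cat.Hom₂.id_app, Category.comp_id]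

lemma compInv_map₂_id {a b c : A} (f : a ⟶ b) (g : b ⟶ c) (x : U.obj a) :
    U.compInv f g x ≫ (U.map₂ (𝟙 (f ≫ g))).toNatTrans.app x = U.compInv f g x := by
  rw [U.map₂_id, Cat.Hom₂.id_app, Category.comp_id]

lemma map₂_rightUnitor_app {a b : A} (f : a ⟶ b) (x : U.obj a) :
    (U.map₂ (ρ_ f).hom).toNatTrans.app x =
      U.compHom f (𝟙 b) x ≫ U.idHom b ((U.map f).toFunctor.obj x) := by
  have h : _ = U.compHom f (𝟙 b) x ≫ U.idHom b ((U.map f).toFunctor.obj x) ≫ 𝟙 _ :=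
    congrArg (fun t => t.toNatTrans.app x) (U.map₂_right_unitor f)
  rw [Category.comp_id] at h
  exact h

lemma map₂_leftUnitor_app {a b : A} (f : a ⟶ b) (x : U.obj a) :
    (U.map₂ (λ_ f).hom).toNatTrans.app x =
      U.compHom (𝟙 a) f x ≫ (U.map f).toFunctor.map (U.idHom a x) := by
  have h : _ = U.compHom (𝟙 a) f x ≫ (U.map f).toFunctor.map (U.idHom a x) ≫ 𝟙 _ :=
    congrArg (fun t => t.toNatTrans.app x) (U.map₂_left_unitor f)
  rw [Category.comp_id] at h
  exact h

end CategoryTheory.StrictPseudofunctor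

namespace Elements

open CategoryTheory.Lax.LaxTrans

variable {A : Type u} [Bicategory.{w, v} A]

/-- The unbundled data of a lax transformation from `Δ1` to `U ∘ proj F`. -/
structure Cocone (F U : StrictPseudofunctor A Cat.{v', u'}) where
  obj (a : A) (x : F.obj a) : U.obj a
  map {a b : A} (f : a ⟶ b) {x : F.obj a} {y : F.obj b} (α : (F.map f).toFunctor.obj x ⟶ y) :
    (U.map f).toFunctor.obj (obj a x) ⟶ obj b y
  map_map₂ {a b : A} {f g : a ⟶ b} (η : f ⟶ g) {x : F.obj a} {y : F.obj b}
    (β : (F.map g).toFunctor.obj x ⟶ y) :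
    map f ((F.map₂ η).toNatTrans.app x ≫ β) =
      (U.map₂ η).toNatTrans.app (obj a x) ≫ map g β
  map_id (a : A) (x : F.obj a) : U.idInv a (obj a x) ≫ map (𝟙 a) (F.idHom a x) = 𝟙 _
  map_comp {a b c : A} (f : a ⟶ b) (g : b ⟶ c) {x : F.obj a} {y : F.obj b} {z : F.obj c}
    (α : (F.map f).toFunctor.obj x ⟶ y) (β : (F.map g).toFunctor.obj y ⟶ z) :
    U.compInv f g (obj a x) ≫ map (f ≫ g) (F.compHom f g x ≫ (F.map g).toFunctor.map α ≫ β) =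
      (U.map g).toFunctor.map (map f α) ≫ map g β

namespace Cocone

variable {F U : StrictPseudofunctor A Cat.{v', u'}} (s : Cocone F U)

/-- The action of a cocone on the morphisms of a fiber. -/
def fiberMap {a : A} {x y : F.obj a} (k : x ⟶ y) : s.obj a x ⟶ s.obj a y :=
  U.idInv a (s.obj a x) ≫ s.map (𝟙 a) (F.idHom a x ≫ k)

lemma map_fiberMap {a b : A} (f : a ⟶ b) {x : F.obj a} {y y' : F.obj b}
    (α : (F.map f).toFunctor.obj x ⟶ y) (k : y ⟶ y') :
    s.map f α ≫ s.fiberMap k = s.map f (α ≫ k) := by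
  have h : F.compHom f (𝟙 b) x ≫ (F.map (𝟙 b)).toFunctor.map α ≫ F.idHom b y ≫ k =
      (F.map₂ (ρ_ f).hom).toNatTrans.app x ≫ α ≫ k := by
    rw [F.map₂_rightUnitor_app, reassoc_of% F.idHom_naturality b α, Category.assoc]
  rw [fiberMap, reassoc_of% U.idInv_naturality b (s.map f α), ← s.map_comp, h, s.map_map₂,
    U.map₂_rightUnitor_app, Category.assoc, reassoc_of% U.compInv_compHom f (𝟙 b) (s.obj a x),
    reassoc_of% U.idInv_idHom b ((U.map f).toFunctor.obj (s.obj a x))]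

lemma fiberMap_map {a b : A} (f : a ⟶ b) {x' x : F.obj a} {y : F.obj b} (k : x' ⟶ x)
    (α : (F.map f).toFunctor.obj x ⟶ y) :
    (U.map f).toFunctor.map (s.fiberMap k) ≫ s.map f α =
      s.map f ((F.map f).toFunctor.map k ≫ α) := by
  have h : F.compHom (𝟙 a) f x' ≫ (F.map f).toFunctor.map (F.idHom a x' ≫ k) ≫ α =
      (F.map₂ (λ_ f).hom).toNatTrans.app x' ≫ (F.map f).toFunctor.map k ≫ α := by
    rw [F.map₂_leftUnitor_app, Functor.map_comp, Category.assoc, Category.assoc]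
  rw [fiberMap, Functor.map_comp, Category.assoc, ← s.map_comp, h, s.map_map₂,
    U.map₂_leftUnitor_app]
  rw [Category.assoc, reassoc_of% U.compInv_compHom (𝟙 a) f (s.obj a x'),
    ← Functor.map_comp_assoc, U.idInv_idHom, CategoryTheory.Functor.map_id, Category.id_comp]

/-- The action of a cocone on a fiber. -/
def fiberFunctor (a : A) : F.obj a ⥤ U.obj a where
  obj := s.obj a
  map k := s.fiberMap k
  map_id x := by rw [fiberMap, Category.comp_id, s.map_id]
  map_comp k l := by rw [fiberMap, fiberMap, Category.assoc, map_fiberMap, Category.assoc]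

lemma map_id_naturality {a b : A} (f : a ⟶ b) {x y : F.obj a} (k : x ⟶ y) :
    (U.map f).toFunctor.map (s.fiberMap k) ≫ s.map f (𝟙 _) =
      s.map f (𝟙 _) ≫ s.fiberMap ((F.map f).toFunctor.map k) := by
  rw [fiberMap_map, map_fiberMap, Category.comp_id, Category.id_comp]

lemma map_id_map₂ {a b : A} {f g : a ⟶ b} (η : f ⟶ g) (x : F.obj a) :
    s.map f (𝟙 _) ≫ s.fiberMap ((F.map₂ η).toNatTrans.app x) =
      (U.map₂ η).toNatTrans.app (s.obj a x) ≫ s.map g (𝟙 _) := by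
  rw [map_fiberMap, ← s.map_map₂, Category.comp_id, Category.id_comp]

lemma idInv_map_id (a : A) (x : F.obj a) :
    U.idInv a (s.obj a x) ≫ s.map (𝟙 a) (𝟙 _) = s.fiberMap (F.idInv a x) := by
  rw [fiberMap, F.idHom_idInv]

lemma compInv_map_id {a b c : A} (f : a ⟶ b) (g : b ⟶ c) (x : F.obj a) :
    U.compInv f g (s.obj a x) ≫ s.map (f ≫ g) (𝟙 _) =
      (U.map g).toFunctor.map (s.map f (𝟙 _)) ≫ s.map g (𝟙 _) ≫
        s.fiberMap (F.compInv f g x) := by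
  rw [map_fiberMap, ← s.map_comp, CategoryTheory.Functor.map_id, Category.id_comp,
    Category.id_comp, F.compHom_compInv]

/-- The lax transformation out of `F` corresponding to a cocone. -/
def toTrans : laxOf F ⟶ laxOf U :=
  ofCells (M := laxOf F) (N := laxOf U) s.fiberFunctor (fun f _ => s.map f (𝟙 _))
    s.map_id_naturality s.map_id_map₂ s.idInv_map_id s.compInv_map_id

lemma fiberMap_comp_eq {s s' : Cocone F U} (t : ∀ a x, s.obj a x ⟶ s'.obj a x)
    (ht : ∀ {a b : A} (f : a ⟶ b) {x : F.obj a} {y : F.obj b}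
      (α : (F.map f).toFunctor.obj x ⟶ y),
      (U.map f).toFunctor.map (t a x) ≫ s'.map f α = s.map f α ≫ t b y)
    {a : A} {x y : F.obj a} (k : x ⟶ y) : s.fiberMap k ≫ t a y = t a x ≫ s'.fiberMap k := by
  rw [fiberMap, Category.assoc, ← ht, fiberMap, reassoc_of% U.idInv_naturality a (t a x)]

end Cocone

/-- The object of the terminal category. -/
abbrev point : Cat.chosenTerminal.{v', u'} := ⟨⟨()⟩⟩

variable [Bicategory.Strict A] {F U : StrictPseudofunctor A Cat.{v', u'}}

lemma map_terminal {D : Type u} [Category.{v} D] (G : Cat.chosenTerminal.{v', u'} ⥤ D)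
    {p q : Cat.chosenTerminal.{v', u'}} (k : p ⟶ q) : G.map k ≍ 𝟙 (G.obj point) := by
  obtain ⟨⟨⟨⟩⟩⟩ := p
  obtain ⟨⟨⟨⟩⟩⟩ := q
  exact heq_of_eq (G.map_id point)

/-- The structure 2-cells of a lax transformation from `Δ1`, as morphisms. -/
def leg (ψ : laxOf (constOne (Elements F)) ⟶ laxOf ((proj F).comp U)) {x y : Elements F}
    (f : x ⟶ y) :
    (U.map f.base).toFunctor.obj ((ψ.app x).toFunctor.obj point) ⟶
      (ψ.app y).toFunctor.obj point :=
  cell ψ f point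

/-- The data of a lax transformation from `Δ1`. -/
def toCocone (ψ : laxOf (constOne (Elements F)) ⟶ laxOf ((proj F).comp U)) : Cocone F U where
  obj a x := (ψ.app ⟨a, x⟩).toFunctor.obj point
  map {a b} f {x y} α := leg ψ (x := ⟨a, x⟩) (y := ⟨b, y⟩) (Hom.mk f α)
  map_map₂ {a b f g} η {x y} β := by
    have h := cell_map₂ ψ (mk₂ (x := ⟨a, x⟩) (y := ⟨b, y⟩) 
      (f := Hom.mk f ((F.map₂ η).toNatTrans.app x ≫ β)) (g := Hom.mk g β) η rfl) point
    refine Eq.trans ?_ h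
    exact ((congrArg (_ ≫ ·) (CategoryTheory.Functor.map_id _ _)).trans (Category.comp_id _)).symm
  map_id a x := by
    have h := cell_id ψ ⟨a, x⟩ point
    refine Eq.trans ?_ (h.trans (CategoryTheory.Functor.map_id _ _))
    exact (congrArg (· ≫ cell ψ (𝟙 (⟨a, x⟩ : Elements F)) point) (U.idInv_map₂_id a _)).symm
  map_comp {a b c} f g {x y z} α β := by
    have h := cell_comp ψ (a := ⟨a, x⟩) (b := ⟨b, y⟩) (c := ⟨c, z⟩) (Hom.mk f α) (Hom.mk g β)
      point
    refine Eq.trans ?_ (h.trans (congrArg (_ ≫ ·)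
      ((congrArg (_ ≫ ·) (CategoryTheory.Functor.map_id _ _)).trans (Category.comp_id _))))
    exact (congrArg (· ≫ leg ψ (x := ⟨a, x⟩) (y := ⟨c, z⟩) (Hom.mk (f ≫ g) _))
      (U.compInv_map₂_id f g _)).symm

lemma cell_pasting (φ : laxOf F ⟶ laxOf U) {x y : Elements F} (f : x ⟶ y)
    (p : Cat.chosenTerminal.{v', u'}) :
    cell ((pasting (cone F) U).obj φ) f p =
      cell φ f.base x.fiber ≫ (φ.app y.base).toFunctor.map f.fiber := by
  change 𝟙 _ ≫ cell φ f.base x.fiber ≫ 𝟙 _ ≫ (φ.app y.base).toFunctor.map f.fiber ≫ 𝟙 _ = _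
  simp only [Category.id_comp, Category.comp_id]

lemma cell_pasting_lift (φ : laxOf F ⟶ laxOf U) {a b : A} (f : a ⟶ b) (x : F.obj a)
    (p : Cat.chosenTerminal.{v', u'}) :
    cell ((pasting (cone F) U).obj φ) (lift f x) p = cell φ f x :=
  (cell_pasting φ (lift f x) p).trans
    ((congrArg (_ ≫ ·) (CategoryTheory.Functor.map_id _ _)).trans (Category.comp_id _))

lemma fiberMap_pasting (φ : laxOf F ⟶ laxOf U) {a : A} {x y : F.obj a} (k : x ⟶ y) :
    (toCocone ((pasting (cone F) U).obj φ)).fiberMap k = (φ.app a).toFunctor.map k := by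
  have h : U.idInv a ((φ.app a).toFunctor.obj x) ≫ cell φ (𝟙 a) x =
    (φ.app a).toFunctor.map (F.idInv a x) := cell_id φ a x
  refine (congrArg (U.idInv a ((φ.app a).toFunctor.obj x) ≫ ·)
    (cell_pasting φ (x := ⟨a, x⟩) (y := ⟨a, y⟩) (Hom.mk (𝟙 a) (F.idHom a x ≫ k)) point)).trans ?_
  refine (Category.assoc _ _ _).symm.trans ((congrArg (· ≫ _) h).trans ?_)
  refine ((φ.app a).toFunctor.map_comp _ _).symm.trans ?_
  exact congrArg _ ((reassoc_of% F.idInv_idHom a x) k)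

lemma toTrans_toCocone_pasting (φ : laxOf F ⟶ laxOf U) :
    (toCocone ((pasting (cone F) U).obj φ)).toTrans = φ :=
  ext_cells (fun _ _ => rfl) (fun _ _ _ k => heq_of_eq (fiberMap_pasting φ k))
    (fun f x => heq_of_eq (cell_pasting_lift φ f x point))

lemma pasting_toTrans_toCocone
    (ψ : laxOf (constOne (Elements F)) ⟶ laxOf ((proj F).comp U)) :
    (pasting (cone F) U).obj (toCocone ψ).toTrans = ψ :=
  ext_cells (fun _ _ => rfl)
    (fun x _ _ k => (map_terminal _ k).trans (map_terminal (ψ.app x).toFunctor k).symm)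
    (fun f p => heq_of_eq ((cell_pasting _ f p).trans
      (((toCocone ψ).map_fiberMap f.base (𝟙 _) f.fiber).trans
        (congrArg (toCocone ψ |>.map f.base) (Category.id_comp f.fiber)))))

instance faithful_pasting : (pasting (cone F) U).Faithful where
  map_injective h := hom_ext_app fun a x =>
    congrArg (fun t => (t.as.app ⟨a, x⟩).toNatTrans.app point) h

instance full_pasting : (pasting (cone F) U).Full where
  map_surjective {φ φ'} Γ := by
    let s := toCocone ((pasting (cone F) U).obj φ)
    let s' := toCocone ((pasting (cone F) U).obj φ')
    let t : ∀ a x, s.obj a x ⟶ s'.obj a x := fun a x => (Γ.as.app ⟨a, x⟩).toNatTrans.app point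
    have ht {a b : A} (f : a ⟶ b) {x : F.obj a} {y : F.obj b}
        (α : (F.map f).toFunctor.obj x ⟶ y) :
        (U.map f).toFunctor.map (t a x) ≫ s'.map f α = s.map f α ≫ t b y :=
      modification_naturality_app Γ (a := ⟨a, x⟩) (b := ⟨b, y⟩) (Hom.mk f α) point
    refine ⟨homOfApp t (fun a x y k => ?_) (fun {a b} f x => ?_), hom_ext_app fun _ _ => rfl⟩
    · exact (congrArg (· ≫ t a y) (fiberMap_pasting φ k).symm).trans
        ((Cocone.fiberMap_comp_eq t ht k).trans
          (congrArg (t a x ≫ ·) (fiberMap_pasting φ' k)))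
    · exact (congrArg ((U.map f).toFunctor.map (t a x) ≫ ·)
        (cell_pasting_lift φ' f x point).symm).trans
          ((ht f (𝟙 _)).trans (congrArg (· ≫ t b _) (cell_pasting_lift φ f x point)))

variable (F) in
theorem isWeakLeftKanExtension_cone : IsWeakLeftKanExtension (cone F) := fun _ =>
  { faithful := inferInstance
    full := inferInstance
    bijective_obj := Function.bijective_iff_has_inverse.2
      ⟨fun ψ => (toCocone ψ).toTrans, toTrans_toCocone_pasting, pasting_toTrans_toCocone⟩ }

lemma isPseudonatural_iff_isSigma_pasting (φ : laxOf F ⟶ laxOf U) :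
    isPseudonatural F U φ ↔
      isSigma (constOne (Elements F)) ((proj F).comp U) ((pasting (cone F) U).obj φ) := by
  constructor
  · intro h a b f x
    refine (Cat.isIso_iff_app _).2 fun p => ?_
    have h' : IsIso (cell φ f x) := (Cat.isIso_iff_app _).1 (h f) x
    rw [← cell_pasting_lift φ f x p] at h'
    exact h'
  · intro h a b f
    refine (Cat.isIso_iff_app _).2 fun x => ?_
    have h' : IsIso (cell ((pasting (cone F) U).obj φ) (lift f x) point) :=
      (Cat.isIso_iff_app _).1 (h f x) point
    rw [cell_pasting_lift φ f x point] at h'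
    exact h'

lemma isTwoNatural_iff_isCartesianMarked_pasting (φ : laxOf F ⟶ laxOf U) :
    isTwoNatural F U φ ↔
      isCartesianMarked (constOne (Elements F)) ((proj F).comp U)
        ((pasting (cone F) U).obj φ) := by
  constructor
  · intro h a b f x
    refine (Cat.isIdentityTwoCell_iff_app _).2 fun p => ?_
    obtain ⟨e, h'⟩ := (Cat.isIdentityTwoCell_iff_app _).1 (h f) x
    exact ⟨e, (cell_pasting_lift φ f x p).trans h'⟩
  · intro h a b f
    refine (Cat.isIdentityTwoCell_iff_app _).2 fun x => ?_
    obtain ⟨e, h'⟩ := (Cat.isIdentityTwoCell_iff_app _).1 (h f x) point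
    exact ⟨e, (cell_pasting_lift φ f x point).symm.trans h'⟩

end Elements

namespace CategoryTheory.Lax.LaxTrans

variable {B : Type u₁} [Bicategory.{w₁, v₁} B] {M N P : B ⥤ᴸ Cat.{v', u'}}

lemma cell_comp_trans (φ : M ⟶ N) (θ : N ⟶ P) {a b : B} (f : a ⟶ b) (x : M.obj a) :
    cell (φ ≫ θ) f x =
      cell θ f ((φ.app a).toFunctor.obj x) ≫ (θ.app b).toFunctor.map (cell φ f x) := by
  change 𝟙 _ ≫ cell θ f ((φ.app a).toFunctor.obj x) ≫ 𝟙 _ ≫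
    (θ.app b).toFunctor.map (cell φ f x) ≫ 𝟙 _ = _
  simp only [Category.id_comp, Category.comp_id]

lemma eq_eqToHom_comp_of_heq {φ ψ φ' ψ' : M ⟶ N} {Γ : φ ⟶ ψ} {Γ' : φ' ⟶ ψ'}
    (h : φ = φ') (h' : ψ' = ψ)
    (e : ∀ a x, (Γ.as.app a).toNatTrans.app x ≍ (Γ'.as.app a).toNatTrans.app x) :
    Γ = eqToHom h ≫ Γ' ≫ eqToHom h' := by
  subst h h'
  rw [eqToHom_refl, eqToHom_refl, Category.id_comp, Category.comp_id]
  exact hom_ext_app fun a x => eq_of_heq (e a x)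

end CategoryTheory.Lax.LaxTrans

namespace Elements

open CategoryTheory.Lax.LaxTrans

variable {A : Type u} [Bicategory.{w, v} A] [Bicategory.Strict A]
  {F U U' : StrictPseudofunctor A Cat.{v', u'}}

lemma pasting_comp (φ : laxOf F ⟶ laxOf U) (θ : laxOf U ⟶ laxOf U') :
    (pasting (cone F) U).obj φ ≫ (restrictFunctor (proj F) U U').obj θ =
      (pasting (cone F) U').obj (φ ≫ θ) :=
  ext_cells (fun _ _ => rfl) (fun _ _ _ _ => HEq.rfl) fun {x y} f p => heq_of_eq <| by
    refine (cell_comp_trans _ _ f p).trans (Eq.trans ?_ (cell_pasting (φ ≫ θ) f p).symm)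
    refine (congrArg (fun t => cell θ f.base ((φ.app x.base).toFunctor.obj x.fiber) ≫
      (θ.app y.base).toFunctor.map t) (cell_pasting φ f p)).trans ?_
    refine (congrArg (_ ≫ ·) ((θ.app y.base).toFunctor.map_comp _ _)).trans ?_
    refine (Category.assoc _ _ _).symm.trans ?_
    exact congrArg (· ≫ (θ.app y.base).toFunctor.map ((φ.app y.base).toFunctor.map f.fiber))
      (cell_comp_trans φ θ f.base x.fiber).symm

lemma pasting_postcomposing (θ : laxOf U ⟶ laxOf U') :
    pasting (cone F) U ⋙ (postcomposing (B := LaxFunctor (Elements F) Cat.{v', u'})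
        (laxOf (constOne (Elements F))) _ _).obj ((restrictFunctor (proj F) U U').obj θ) =
      (postcomposing (B := LaxFunctor A Cat.{v', u'}) (laxOf F) _ _).obj θ ⋙
        pasting (cone F) U' :=
  CategoryTheory.Functor.ext (fun φ => pasting_comp φ θ)
    fun _ _ _ => eq_eqToHom_comp_of_heq _ _ fun _ _ => HEq.rfl

variable (F) in
theorem pastingIsTwoNatural_cone : PastingIsTwoNatural (cone F) where
  natural := pasting_postcomposing
  natural_two {U U' θ θ'} Γ := by
    ext φ : 2
    rw [NatTrans.comp_app, NatTrans.comp_app, eqToHom_app, eqToHom_app]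
    exact eq_eqToHom_comp_of_heq _ _ fun _ _ => HEq.rfl

end Elements

theorem mainTheorem7 {A : Type u} [Bicategory.{w, v} A] [Bicategory.Strict A]
    (F : StrictPseudofunctor A Cat.{v', u'}) :
    IsWeakLeftKanExtension (Elements.cone F) ∧
    PastingIsTwoNatural (Elements.cone F) ∧
    (∀ U : StrictPseudofunctor A Cat.{v', u'},
      RestrictsToIso (pasting (Elements.cone F) U) (isPseudonatural F U)
        (Elements.isSigma (constOne (Elements F)) ((Elements.proj F).comp U))) ∧
    (∀ U : StrictPseudofunctor A Cat.{v', u'},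
      RestrictsToIso (pasting (Elements.cone F) U) (isTwoNatural F U)
        (Elements.isCartesianMarked (constOne (Elements F)) ((Elements.proj F).comp U))) :=
  ⟨Elements.isWeakLeftKanExtension_cone F, Elements.pastingIsTwoNatural_cone F,
    fun U => .of_iff (Elements.isWeakLeftKanExtension_cone F U)
      Elements.isPseudonatural_iff_isSigma_pasting,
    fun U => .of_iff (Elements.isWeakLeftKanExtension_cone F U)
      Elements.isTwoNatural_iff_isCartesianMarked_pasting⟩
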